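/- Let $(R,\mathfrak m,K)$ be either a Noetherian local ring with maximal ideal $\mathfrak m$ and residue field $K=R/\mathfrak m$, or a standard graded $K$-algebra $R=\bigoplus_{k\ge 0}R_k$ over a field $K$ (that is, $R_0=K$ and $R$ is generated as a $K$-algebra by the finite dimensional space $R_1$) with $\mathfrak m=\bigoplus_{k>0}R_k$. Assume that $K$ is infinite and $\operatorname{depth}R>0$. Let $I\subseteq R$ be an ideal, homogeneous in the graded case. An ideal $J$ is called $\mathfrak m$-full if $(J\mathfrak m:x)=J$ for a generic $x\in\mathfrak m\setminus\mathfrak m^2$, full if $(J:x)=(J:\mathfrak m)$ for a generic $x\in\mathfrak m\setminus\mathfrak m^2$, and weakly $\mathfrak m$-full if $(J\mathfrak m:\mathfrak m)=J$; here "generic" means: for all $x\in\mathfrak m\setminus\mathfrak m^2$ whose class lies in some non-empty Zariski open subset of the vector space $\mathfrak m/\mathfrak m^2$. Let $\mathfrak d_1(I)$, $\mathfrak d_2(I)$, $\mathfrak d_3(I)$ be the least $\ell\ge 0$ such that $I\mathfrak m^k$ is, respectively, $\mathfrak m$-full, full, weakly $\mathfrak m$-full for all $k\ge\ell$. Let $\mathcal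 R(\mathfrak m)=\bigoplus_{k\ge0}\mathfrak m^k$ be the Rees algebra of $\mathfrak m$, let $\mathcal R(\mathfrak m,I)=\bigoplus_{k\ge 0}I\mathfrak m^k$ be the extension of $I$ to it, and let $\operatorname{gr}_{\mathfrak m}(R)=\bigoplus_{k\ge0}\mathfrak m^k/\mathfrak m^{k+1}$. For a non-zero finitely generated graded $\mathcal R(\mathfrak m)$-module $M=\bigoplus_{k\ge 0}M_k$, put $$\operatorname{reg}_{\mathcal R(\mathfrak m)}M=\max\{\,j-i\;:\;H_i(y_1,\dots,y_n;M)_j\neq0\,\},$$ where $y_1,\dots,y_n$ is any minimal homogeneous system of generators of $\mathcal R(\mathfrak m)_+=\bigoplus_{k>0}\mathfrak m^k$ and $H_i$ denotes Koszul homology. Suppose in addition that $\operatorname{depth}\operatorname{gr}_{\mathfrak m}(R)>0$. Then the numbers $\mathfrak d_i(I)$ are well defined (finite) and $$\mathfrak d_2(I)\le\mathfrak d_3(I)=\mathfrak d_1(I),$$ and if $I\ne0$, then moreover $\operatorname{reg}_{\mathcal R(\mathfrak m)}\mathcal R(\mathfrak m,I)$ is finite and $$\mathfrak d_1(I)\le\operatorname{reg}_{\mathcal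 R(\mathfrak m)}\mathcal R(\mathfrak m,I).$$ -/

import Mathlib

open Polynomial

noncomputable section

/-! ### Generic elements and the fullness conditions -/

/-- The value at `v` of a polynomial function on the `A`-module `V`, that is, of a polynomial in
the linear forms on `V`. -/
def evalPolyFun {A V : Type*} [CommRing A] [AddCommGroup V] [Module A V]
    (p : MvPolynomial (Module.Dual A V) A) (v : V) : A :=
  MvPolynomial.eval (fun φ => φ v) p

/-- Zariski open subsets of a vector space `V`: the complements of the common zero loci of
families of polynomial functions. -/
def IsZariskiOpen (A : Type*) {V : Type*} [CommRing A] [AddCommGroup V] [Module A V]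
    (U : Set V) : Prop :=
  ∃ F : Set (MvPolynomial (Module.Dual A V) A), U = {v | ∃ p ∈ F, evalPolyFun p v ≠ 0}

/-- `P x` holds for a generic element `x ∈ 𝔪 ∖ 𝔪²`: it holds for all `x ∈ 𝔪 ∖ 𝔪²` whose class lies
in some non-empty Zariski open subset of the `R/𝔪`-vector space `𝔪/𝔪²`. -/
def ForGeneric {R : Type*} [CommRing R] (m : Ideal R) (P : R → Prop) : Prop :=
  ∃ U : Set m.Cotangent, IsZariskiOpen (R ⧸ m) U ∧ U.Nonempty ∧
    ∀ x : m, (x : R) ∉ m ^ 2 → m.toCotangent x ∈ U → P x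

/-- `I` is `𝔪`-full: `(I𝔪 : x) = I` for a generic `x ∈ 𝔪 ∖ 𝔪²`. -/
def IsMFull {R : Type*} [CommRing R] (m I : Ideal R) : Prop :=
  ForGeneric m fun x => (I * m).colon {x} = I

/-- `I` is full: `(I : x) = (I : 𝔪)` for a generic `x ∈ 𝔪 ∖ 𝔪²`. -/
def IsFull {R : Type*} [CommRing R] (m I : Ideal R) : Prop :=
  ForGeneric m fun x => I.colon {x} = I.colon (m : Set R)

/-- `I` is weakly `𝔪`-full: `(I𝔪 : 𝔪) = I`. -/
def IsWeaklyMFull {R : Type*} [CommRing R] (m I : Ideal R) : Prop :=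
  (I * m).colon (m : Set R) = I

/-- The least `ℓ ≥ 0` such that `I𝔪ᵏ` has the property `P` for all `k ≥ ℓ`
(and `⊤` if there is no such `ℓ`). -/
def leastStable {R : Type*} [CommRing R] (P : Ideal R → Prop) (m I : Ideal R) : ℕ∞ :=
  ⨅ (l : ℕ) (_ : ∀ k, l ≤ k → P (I * m ^ k)), (l : ℕ∞)

/-- The first Dao number `𝔡₁(I)`. -/
def dao₁ {R : Type*} [CommRing R] (m I : Ideal R) : ℕ∞ := leastStable (IsMFull m) m I

/-- The second Dao number `𝔡₂(I)`. -/
def dao₂ {R : Type*} [CommRing R] (m I : Ideal R) : ℕ∞ := leastStable (IsFull m) m I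

/-- The third Dao number `𝔡₃(I)`. -/
def dao₃ {R : Type*} [CommRing R] (m I : Ideal R) : ℕ∞ := leastStable (IsWeaklyMFull m) m I

/-! ### Depth -/

/-- The supremum of the lengths of the `A`-regular sequences with entries in the ideal `J`. For a
Noetherian local ring with maximal ideal `J`, or a standard graded algebra over a field with
homogeneous maximal ideal `J`, this is the depth of `A`. -/
def ringDepth {A : Type*} [CommRing A] (J : Ideal A) : ℕ∞ :=
  ⨆ (s : List A) (_ : (∀ a ∈ s, a ∈ J) ∧ RingTheory.Sequence.IsRegular A s), (s.length : ℕ∞)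

/-! ### The Rees algebra `ℛ(𝔪) = ⨁ 𝔪ᵏ`, its extension ideals, and the associated graded ring -/

/-- The homogeneous component `ℛ(𝔪)_k = 𝔪ᵏ` of the Rees algebra (realised as `𝔪ᵏ tᵏ ⊆ R[t]`). -/
def reesPiece {R : Type*} [CommRing R] (m : Ideal R) (k : ℕ) : AddSubgroup (reesAlgebra m) where
  carrier := {f | ∀ j, j ≠ k → (f : R[X]).coeff j = 0}
  zero_mem' := by intro j _; simp
  add_mem' := by
    intro f g hf hg j hj
    simp [hf j hj, hg j hj]
  neg_mem' := by
    intro f hf j hj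
    simp [hf j hj]

/-- The ideal `ℛ(𝔪)₊ = ⨁_{k>0} 𝔪ᵏ` of the Rees algebra. -/
def reesPlus {R : Type*} [CommRing R] (m : Ideal R) : Ideal (reesAlgebra m) where
  carrier := {f | (f : R[X]).coeff 0 = 0}
  zero_mem' := by simp
  add_mem' := by
    intro f g hf hg
    simp only [Set.mem_ofPred_eq] at hf hg ⊢
    simp [hf, hg]
  smul_mem' := by
    intro c f hf
    simp only [Set.mem_ofPred_eq] at hf ⊢
    simp [Polynomial.mul_coeff_zero, hf]

/-- The ideal `ℛ(𝔪, I) = ⨁ I𝔪ᵏ` of the Rees algebra. -/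
def reesExt {R : Type*} [CommRing R] (m I : Ideal R) : Ideal (reesAlgebra m) where
  carrier := {f | ∀ k, (f : R[X]).coeff k ∈ I * m ^ k}
  zero_mem' := by intro k; simp
  add_mem' := by
    intro f g hf hg k
    simpa using add_mem (hf k) (hg k)
  smul_mem' := by
    intro c f hf k
    have h : ((c • f : reesAlgebra m) : R[X]) = (c : R[X]) * (f : R[X]) := rfl
    rw [h, coeff_mul]
    refine Ideal.sum_mem _ fun p hp => ?_
    obtain rfl : p.1 + p.2 = k := by simpa using hp
    rw [pow_add, mul_left_comm]
    exact Ideal.mul_mem_mul (c.2 p.1) (hf p.2)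

/-- The homogeneous component `ℛ(𝔪, I)_k = I𝔪ᵏ` of the graded module `ℛ(𝔪, I)`. -/
def reesExtPiece {R : Type*} [CommRing R] (m I : Ideal R) (k : ℕ) : AddSubgroup (reesExt m I) :=
  (reesPiece m k).comap (reesExt m I).subtype.toAddMonoidHom

/-- The associated graded ring `gr_𝔪(R) = ⨁ 𝔪ᵏ/𝔪ᵏ⁺¹`, as the quotient of `ℛ(𝔪) = ⨁ 𝔪ᵏ` by its
homogeneous ideal `ℛ(𝔪, 𝔪) = ⨁ 𝔪ᵏ⁺¹`. -/
abbrev AssocGraded {R : Type*} [CommRing R] (m : Ideal R) : Type _ :=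
  reesAlgebra m ⧸ reesExt m m

/-- The ideal `⨁_{k>0} 𝔪ᵏ/𝔪ᵏ⁺¹` of `gr_𝔪(R)`. -/
def assocGradedPlus {R : Type*} [CommRing R] (m : Ideal R) : Ideal (AssocGraded m) :=
  (reesPlus m).map (Ideal.Quotient.mk (reesExt m m))

/-- The depth of `gr_𝔪(R)`. -/
def grDepth {R : Type*} [CommRing R] (m : Ideal R) : ℕ∞ :=
  ringDepth (A := AssocGraded m) (assocGradedPlus m)

/-! ### Koszul homology and Castelnuovo–Mumford regularity -/

section Koszul

variable {S : Type*} [CommRing S] {n : ℕ} (y : Fin n → S) (M : Type*) [AddCommGroup M] [Module S M]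

/-- The differential of the Koszul complex `⨁_T M e_T`, where `T` runs through the subsets of
`{1, …, n}`: it maps `x e_T` to `∑_{a ∈ T} (-1)^{#{b ∈ T : b < a}} y_a x e_{T ∖ {a}}`. Below, a
chain `∑ x_T e_T` is the function `T ↦ x_T`. -/
def koszulD : (Finset (Fin n) → M) →ₗ[S] (Finset (Fin n) → M) where
  toFun x T := ∑ a ∈ Tᶜ, ((-1) ^ (T.filter (· < a)).card * y a) • x (insert a T)
  map_add' x x' := by
    ext T
    simp [Finset.sum_add_distrib]
  map_smul' c x := by
    ext T
    simp only [Pi.smul_apply, RingHom.id_apply, Finset.smul_sum]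
    exact Finset.sum_congr rfl fun a _ => smul_comm _ _ _

/-- The chains `K_i` of homological degree `i`: combinations of the `e_T` with `#T = i`. -/
def koszulChains (S : Type*) [CommRing S] (n : ℕ) (M : Type*) [AddCommGroup M] [Module S M]
    (i : ℕ) : Submodule S (Finset (Fin n) → M) where
  carrier := {x | ∀ T, T.card ≠ i → x T = 0}
  zero_mem' := by intro T _; rfl
  add_mem' := by
    intro x x' hx hx' T hT
    simp [hx T hT, hx' T hT]
  smul_mem' := by
    intro c x hx T hT
    simp [hx T hT]

/-- The cycles `Z_i`. -/
def koszulCycles (i : ℕ) : Submodule S (Finset (Fin n) → M) :=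
  koszulChains S n M i ⊓ LinearMap.ker (koszulD y M)

/-- The boundaries `B_i`. -/
def koszulBoundaries (i : ℕ) : Submodule S (Finset (Fin n) → M) :=
  (koszulChains S n M (i + 1)).map (koszulD y M)

/-- The Koszul homology `H_i(y; M) = Z_i / B_i`. -/
abbrev KoszulHomology (i : ℕ) : Type _ :=
  koszulCycles y M i ⧸ (koszulBoundaries y M i).comap (koszulCycles y M i).subtype

variable {M} (ℳ : ℕ → AddSubgroup M)

/-- The homogeneous component `H_i(y; M)_{i+r}` for the graded module `M = ⨁ ℳ_k` and elements
`y_a` of degree one. As `e_T` has degree `#T`, a chain of `K_i` is homogeneous of degree `i + r`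
if and only if all its coefficients lie in `ℳ_r`. -/
def koszulHomologyPiece (i r : ℕ) : AddSubgroup (KoszulHomology y M i) :=
  ((AddSubgroup.pi Set.univ fun _ : Finset (Fin n) => ℳ r).comap
      (koszulCycles y M i).subtype.toAddMonoidHom).map
    (Submodule.mkQ ((koszulBoundaries y M i).comap (koszulCycles y M i).subtype)).toAddMonoidHom

/-- The Castelnuovo–Mumford regularity `max {j - i : H_i(y; M)_j ≠ 0}` of the graded module
`M = ⨁_{k ≥ 0} ℳ_k`, where `y` is a system of generators, of degree one, of the ideal of elements
of positive degree of a standard graded ring. It is `⊥ = -∞` for `M = 0`; note that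
`H_i(y; M)_j = 0` for `j < i`. -/
def cmRegularity : WithBot ℕ∞ :=
  ⨆ (i : ℕ) (r : ℕ) (_ : koszulHomologyPiece y ℳ i r ≠ ⊥), ((r : ℕ∞) : WithBot ℕ∞)

end Koszul

/-- `y₁, …, yₙ` is a minimal homogeneous system of generators of the ideal `ℛ(𝔪)₊` (such elements
automatically have degree one). -/
structure IsMinimalReesGenerators {R : Type*} [CommRing R] (m : Ideal R) {n : ℕ}
    (y : Fin n → reesAlgebra m) : Prop where
  homogeneous : ∀ a, ∃ k, y a ∈ reesPiece m k
  span_eq : Ideal.span (Set.range y) = reesPlus m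
  minimal : ∀ a, y a ∉ Ideal.span (y '' {a}ᶜ)

/-- The regularity `reg_{ℛ(𝔪)} ℛ(𝔪, I)`, computed with the generators `y` of `ℛ(𝔪)₊`. -/
def reesRegularity {R : Type*} [CommRing R] (m I : Ideal R) {n : ℕ}
    (y : Fin n → reesAlgebra m) : WithBot ℕ∞ :=
  cmRegularity y (reesExtPiece m I)

/-! ### Standard graded algebras -/

/-- `R = ⨁_{k ≥ 0} 𝒜_k` is a standard graded `K`-algebra: `𝒜₀ = K`, and `R` is generated as a
`K`-algebra by the finite dimensional vector space `𝒜₁`. -/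
structure IsStandardGraded {K R : Type*} [Field K] [CommRing R] [Algebra K R]
    (𝒜 : ℕ → Submodule K R) [GradedAlgebra 𝒜] : Prop where
  zero_eq : 𝒜 0 = 1
  finite_one : Module.Finite K (𝒜 1)
  adjoin_eq_top : Algebra.adjoin K (𝒜 1 : Set R) = ⊤

end

noncomputable section

/-! ### Generic elements -/

/-! A generic `x` avoids, in degree one, the finitely many associated primes of ℛ(𝔪)/ℛ(𝔪, I) not
containing ℛ(𝔪)₊. Hence f ∈ 𝔪ᵏ with fx ∈ I𝔪ᵏ⁺¹ satisfies 𝔪ʲf ⊆ I𝔪ᵏ⁺ʲ for some j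
(`forGeneric_exists_pow_mul_mem`), and positive depth of gr yields that fx ∈ 𝔪ᵏ⁺¹ forces f ∈ 𝔪ᵏ
(`forGeneric_mem_pow`). Weak fullness of I𝔪ᵏ, I𝔪ᵏ⁺¹, … strips off the power of 𝔪, so 𝔡₁ ≤ 𝔡₃; the
other inequalities hold ideal by ideal. Finiteness is Artin–Rees for the ideals (I𝔪ᵏ⁺¹ : 𝔪)
(`dao₃_lt_top`).

If I𝔪ᵏ is not weakly 𝔪-full, there is f ∈ 𝔪ᵏ ∖ I𝔪ᵏ with f𝔪 ⊆ I𝔪ᵏ⁺¹. The Koszul differential of f tᵏ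
e_{1…n}, taken over ℛ(𝔪), is a cycle with coefficients in ℛ(𝔪, I) that bounds nothing there, so the
regularity is at least k + 1 (`le_reesRegularity_of_forall_mul_mem`). It is finite because, by
Artin–Rees, cycles of high degree lie in 𝔪 times cycles, and 𝔪 kills Koszul homology
(`exists_forall_exists_koszulD_eq`).

The local and the graded case share one argument: beyond a Noetherian ring and a maximal 𝔪 with
infinite residue field, it only needs `hI`, that elements of 1 + 𝔪 are nonzerodivisors modulo every
I𝔪ᵏ. -/

theorem evalPolyFun_mul {A V : Type*} [CommRing A] [AddCommGroup V] [Module A V]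
    (p q : MvPolynomial (Module.Dual A V) A) (v : V) :
    evalPolyFun (p * q) v = evalPolyFun p v * evalPolyFun q v := by
  simp [evalPolyFun]

/-- The restriction of a polynomial function to the line `v + T w`. -/
def restrictToLine {A V : Type*} [CommRing A] [AddCommGroup V] [Module A V] (v w : V)
    (p : MvPolynomial (Module.Dual A V) A) : A[X] :=
  MvPolynomial.aeval (fun φ : Module.Dual A V => C (φ v) + X * C (φ w)) p

theorem eval_restrictToLine {A V : Type*} [CommRing A] [AddCommGroup V] [Module A V] (v w : V)
    (p : MvPolynomial (Module.Dual A V) A) (t : A) :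
    (restrictToLine v w p).eval t = evalPolyFun p (v + t • w) := by
  have h : (Polynomial.aeval t : A[X] →ₐ[A] A).comp
      (MvPolynomial.aeval (fun φ : Module.Dual A V => C (φ v) + X * C (φ w))) =
      MvPolynomial.aeval (fun φ : Module.Dual A V => φ (v + t • w)) := by
    ext φ
    simp [mul_comm (φ w)]
  have h2 := DFunLike.congr_fun h p
  simpa [restrictToLine, evalPolyFun, MvPolynomial.aeval_eq_eval, Polynomial.aeval_def] using h2

/-- Two non-empty Zariski open subsets of a vector space over an infinite field intersect. -/
theorem exists_evalPolyFun_mul_ne_zero {A V : Type*} [CommRing A] [IsDomain A] [Infinite A]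
    [AddCommGroup V] [Module A V] {p q : MvPolynomial (Module.Dual A V) A} {v w : V}
    (hp : evalPolyFun p v ≠ 0) (hq : evalPolyFun q w ≠ 0) :
    ∃ u, evalPolyFun (p * q) u ≠ 0 := by
  -- On the line through `v` and `w`, `p` is non-zero at 0 and `q` at 1, so both restrict to
  -- non-zero polynomials in one variable over an infinite domain.
  have h1 : restrictToLine v (w - v) p ≠ 0 := fun h => hp <| by
    simpa [h] using (eval_restrictToLine v (w - v) p 0).symm
  have h2 : restrictToLine v (w - v) q ≠ 0 := fun h => hq <| by
    simpa [h] using (eval_restrictToLine v (w - v) q 1).symm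
  by_contra! h
  refine mul_ne_zero h1 h2 (Polynomial.funext fun t => ?_)
  rw [eval_mul, eval_restrictToLine, eval_restrictToLine, ← evalPolyFun_mul, h, eval_zero]

theorem forGeneric_iff {R : Type*} [CommRing R] {m : Ideal R} {P : R → Prop} :
    ForGeneric m P ↔ ∃ p : MvPolynomial (Module.Dual (R ⧸ m) m.Cotangent) (R ⧸ m),
      (∃ v, evalPolyFun p v ≠ 0) ∧
      ∀ x : m, (x : R) ∉ m ^ 2 → evalPolyFun p (m.toCotangent x) ≠ 0 → P x := by
  constructor
  · rintro ⟨U, ⟨F, rfl⟩, ⟨v, p, hp, hv⟩, h⟩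
    exact ⟨p, ⟨v, hv⟩, fun x hx hpx => h x hx ⟨p, hp, hpx⟩⟩
  · rintro ⟨p, ⟨v, hv⟩, h⟩
    exact ⟨{v | ∃ q ∈ ({p} : Set _), evalPolyFun q v ≠ 0}, ⟨{p}, rfl⟩, ⟨v, p, rfl, hv⟩,
      fun x hx ⟨q, hq, hqx⟩ => h x hx (by rwa [Set.mem_singleton_iff.1 hq] at hqx)⟩

section Generic

variable {R : Type*} [CommRing R] {m : Ideal R}

theorem ForGeneric.mono {P Q : R → Prop} (h : ForGeneric m P)
    (hPQ : ∀ x ∈ m, x ∉ m ^ 2 → P x → Q x) : ForGeneric m Q := by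
  obtain ⟨U, hU, hne, h⟩ := h
  exact ⟨U, hU, hne, fun x hx hxU => hPQ x x.2 hx (h x hx hxU)⟩

theorem ForGeneric.of_forall [m.IsMaximal] {P : R → Prop} (h : ∀ x ∈ m, x ∉ m ^ 2 → P x) :
    ForGeneric m P :=
  forGeneric_iff.2 ⟨1, ⟨0, by simp [evalPolyFun]⟩, fun x hx _ => h x x.2 hx⟩

theorem ForGeneric.and [m.IsMaximal] [Infinite (R ⧸ m)] {P Q : R → Prop}
    (hP : ForGeneric m P) (hQ : ForGeneric m Q) : ForGeneric m fun x => P x ∧ Q x := by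
  obtain ⟨p, ⟨v, hv⟩, hp⟩ := forGeneric_iff.1 hP
  obtain ⟨q, ⟨w, hw⟩, hq⟩ := forGeneric_iff.1 hQ
  refine forGeneric_iff.2 ⟨p * q, exists_evalPolyFun_mul_ne_zero hv hw, fun x hx h => ?_⟩
  rw [evalPolyFun_mul] at h
  exact ⟨hp x hx (left_ne_zero_of_mul h), hq x hx (right_ne_zero_of_mul h)⟩

theorem ForGeneric.finite_forall [m.IsMaximal] [Infinite (R ⧸ m)] {ι : Type*} {s : Set ι}
    (hs : s.Finite) {P : ι → R → Prop} (h : ∀ i ∈ s, ForGeneric m (P i)) :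
    ForGeneric m fun x => ∀ i ∈ s, P i x := by
  induction s, hs using Set.Finite.induction_on with
  | empty => exact .of_forall (by simp)
  | insert _ _ ih =>
    refine ((h _ (Set.mem_insert _ _)).and
      (ih fun i hi => h i (Set.mem_insert_of_mem _ hi))).mono fun x _ _ hx i hi => ?_
    rcases hi with rfl | hi
    exacts [hx.1, hx.2 i hi]

/-- A generic element avoids an ideal that does not generate `𝔪` modulo `𝔪²`. -/
theorem ForGeneric.notMem [hm : m.IsMaximal] {A : Ideal R} (hA : ¬ m ≤ A ⊔ m ^ 2) :
    ForGeneric m (· ∉ A) := by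
  let _ := Ideal.Quotient.field m
  -- The image of A ∩ 𝔪 in 𝔪/𝔪², a proper subspace; a non-zero linear form vanishing on it defines
  -- the open set.
  let W : Submodule (R ⧸ m) m.Cotangent :=
    { (Submodule.map m.toCotangent (Submodule.comap m.subtype A)).toAddSubmonoid with
      smul_mem' := by
        intro c v hv
        obtain ⟨c, rfl⟩ := Ideal.Quotient.mk_surjective c
        exact Submodule.smul_mem (Submodule.map m.toCotangent (Submodule.comap m.subtype A)) c hv }
  have hW : W < ⊤ := by
    rw [lt_top_iff_ne_top]
    refine fun h => hA fun x hx => ?_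
    have hx' : m.toCotangent ⟨x, hx⟩ ∈ W := h ▸ Submodule.mem_top
    obtain ⟨y, hy, hyx⟩ := hx'
    rw [← sub_add_cancel x y, add_comm]
    exact Submodule.add_mem_sup hy (m.toCotangent_eq.1 hyx.symm)
  obtain ⟨φ, hφ, hφW⟩ := Submodule.exists_le_ker_of_lt_top W hW
  obtain ⟨v, hv⟩ : ∃ v, φ v ≠ 0 := by
    by_contra! h
    exact hφ (LinearMap.ext h)
  refine forGeneric_iff.2 ⟨MvPolynomial.X φ, ⟨v, by simpa [evalPolyFun] using hv⟩,
    fun x _ h hxA => h ?_⟩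
  have : m.toCotangent x ∈ W := ⟨x, hxA, rfl⟩
  simpa [evalPolyFun] using hφW this

theorem ForGeneric.exists [m.IsMaximal] [Infinite (R ⧸ m)] {P : R → Prop} (h : ForGeneric m P)
    (hm : ¬ m ≤ m ^ 2) : ∃ x ∈ m, x ∉ m ^ 2 ∧ P x := by
  have h0 : ForGeneric m (· ∉ m ^ 2) := .notMem (by simpa using hm)
  obtain ⟨p, ⟨v, hv⟩, hp⟩ := forGeneric_iff.1 h
  obtain ⟨x, hx, hx2⟩ := SetLike.not_le_iff_exists.1 hm
  let _ := Ideal.Quotient.field m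
  have hne : m.toCotangent ⟨x, hx⟩ ≠ 0 := by simpa [Ideal.toCotangent_eq_zero] using hx2
  obtain ⟨φ, hφ⟩ : ∃ φ : Module.Dual (R ⧸ m) m.Cotangent, φ (m.toCotangent ⟨x, hx⟩) ≠ 0 := by
    by_contra! h
    exact hne ((Module.forall_dual_apply_eq_zero_iff (R ⧸ m) _).1 h)
  -- The factor `φ` forces `u ≠ 0`, so representatives of `u` lie outside 𝔪².
  obtain ⟨u, hu⟩ := exists_evalPolyFun_mul_ne_zero (p := p) (q := MvPolynomial.X φ) hv
    (w := m.toCotangent ⟨x, hx⟩) (by simpa [evalPolyFun] using hφ)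
  rw [evalPolyFun_mul] at hu
  obtain ⟨y, rfl⟩ := m.toCotangent_surjective u
  have hy2 : (y : R) ∉ m ^ 2 := by
    rw [← Ideal.toCotangent_eq_zero]
    intro h0
    exact right_ne_zero_of_mul hu (by simp [evalPolyFun, h0])
  exact ⟨y, y.2, hy2, hp y hy2 (left_ne_zero_of_mul hu)⟩

end Generic


/-! ### Rees algebra and filter-regularity of generic elements -/

theorem Ideal.mem_colon_bot_mk_iff {S : Type*} [CommRing S] {J : Ideal S} {a g : S} :
    a ∈ (⊥ : Submodule S (S ⧸ J)).colon {Ideal.Quotient.mk J g} ↔ a * g ∈ J := by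
  rw [Submodule.mem_colon_singleton, Submodule.mem_bot, ← Ideal.Quotient.eq_zero_iff_mem, map_mul]
  rfl

section Rees

variable {R : Type*} [CommRing R] {m : Ideal R}

/-- The homogeneous element `f tᵏ` of the Rees algebra. -/
abbrev reesMonomial {k : ℕ} {f : R} (hf : f ∈ m ^ k) : reesAlgebra m :=
  ⟨monomial k f, reesAlgebra.monomial_mem.2 hf⟩

theorem reesMonomial_mem_reesExt {I : Ideal R} {k : ℕ} {f : R} (hf : f ∈ m ^ k) :
    reesMonomial hf ∈ reesExt m I ↔ f ∈ I * m ^ k := by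
  constructor
  · intro h
    simpa using h k
  · intro h j
    rcases eq_or_ne k j with rfl | hj
    · simpa using h
    · simp [coeff_monomial, hj]

theorem eq_sum_reesMonomial (f : reesAlgebra m) :
    f = ∑ j ∈ (f : R[X]).support, reesMonomial (f.2 j) := by
  apply Subtype.ext
  rw [AddSubmonoidClass.coe_finsetSum]
  exact (f : R[X]).as_sum_support

theorem reesMonomial_mem_of_forall {P : Ideal (reesAlgebra m)}
    (h : ∀ (x : R) (hx : x ∈ m ^ 1), reesMonomial hx ∈ P) {k : ℕ} {c : R}
    (hc : c ∈ m ^ (k + 1)) : reesMonomial hc ∈ P := by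
  suffices h : ∃ hc : c ∈ m ^ (k + 1), reesMonomial hc ∈ P from h.2
  rw [pow_succ] at hc
  induction hc using Submodule.mul_induction_on' with
  | mem_mul_mem y hy x hx =>
    have hx1 : x ∈ m ^ 1 := by rwa [pow_one]
    refine ⟨Ideal.mul_mem_mul hy hx, ?_⟩
    convert P.mul_mem_left (reesMonomial hy) (h x hx1)
    exact Subtype.ext (by simp [monomial_mul_monomial])
  | add y _ x _ ihy ihx =>
    refine ⟨add_mem ihy.1 ihx.1, ?_⟩
    convert P.add_mem ihy.2 ihx.2
    exact Subtype.ext (by simp)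

/-- `ℛ(𝔪)₊` is generated by its component of degree one. -/
theorem reesPlus_le_iff {P : Ideal (reesAlgebra m)} :
    reesPlus m ≤ P ↔ ∀ (x : R) (hx : x ∈ m ^ 1), reesMonomial hx ∈ P := by
  constructor
  · intro h x hx
    exact h (by change (monomial 1 x).coeff 0 = 0; simp [coeff_monomial])
  · intro h f hf
    rw [eq_sum_reesMonomial f]
    refine sum_mem fun j hj => ?_
    cases j with
    | zero => exact absurd hf (mem_support_iff.1 hj)
    | succ j => exact reesMonomial_mem_of_forall h _

theorem reesMonomial_mem_reesPlus_pow {k : ℕ} {c : R} (hc : c ∈ m ^ k) :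
    reesMonomial hc ∈ reesPlus m ^ k := by
  induction k generalizing c with
  | zero => simp
  | succ k ih =>
    suffices h : ∃ hc : c ∈ m ^ (k + 1), reesMonomial hc ∈ reesPlus m ^ (k + 1) from h.2
    rw [pow_succ] at hc
    induction hc using Submodule.mul_induction_on' with
    | mem_mul_mem y hy x hx =>
      have hx1 : x ∈ m ^ 1 := by rwa [pow_one]
      refine ⟨Ideal.mul_mem_mul hy hx, ?_⟩
      rw [pow_succ (reesPlus m)]
      convert Ideal.mul_mem_mul (ih hy) (reesPlus_le_iff.1 le_rfl x hx1)
      exact Subtype.ext (by simp [monomial_mul_monomial])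
    | add y _ x _ ihy ihx =>
      refine ⟨add_mem ihy.1 ihx.1, ?_⟩
      convert (reesPlus m ^ (k + 1)).add_mem ihy.2 ihx.2
      exact Subtype.ext (by simp)

variable [IsNoetherianRing R]

/-- The radical of the annihilator of `q` is the intersection of its minimal primes, which are
associated primes of `M`. -/
theorem exists_pow_reesPlus_le {M : Type*} [AddCommGroup M] [Module (reesAlgebra m) M] {q : M}
    (h : ∀ P ∈ associatedPrimes (reesAlgebra m) M,
      (⊥ : Submodule (reesAlgebra m) M).colon {q} ≤ P → reesPlus m ≤ P) :
    ∃ j, reesPlus m ^ j ≤ (⊥ : Submodule (reesAlgebra m) M).colon {q} := by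
  refine Ideal.exists_pow_le_of_le_radical_of_fg ?_ (IsNoetherian.noetherian _)
  rw [← Ideal.sInf_minimalPrimes]
  refine le_sInf fun P hP => h P ?_ hP.1.2
  obtain ⟨x, hx⟩ := Submodule.exists_eq_colon_of_mem_minimalPrimes hP
  exact isAssociatedPrime_iff.2 ⟨hP.1.1, x, hx⟩

/-- A generic element of `𝔪` avoids, in degree one, an associated prime of `ℛ(𝔪)/ℛ(𝔪, I)` which
does not contain `ℛ(𝔪)₊`. -/
theorem forGeneric_reesMonomial_notMem [m.IsMaximal] {I : Ideal R}
    (hI : ∀ k, ∀ r ∈ m, ∀ f, (1 - r) * f ∈ I * m ^ k → f ∈ I * m ^ k)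
    {P : Ideal (reesAlgebra m)} (hP : P ∈ associatedPrimes _ (reesAlgebra m ⧸ reesExt m I))
    (hPm : ¬ reesPlus m ≤ P) :
    ForGeneric m fun x => ∀ hx : x ∈ m ^ 1, reesMonomial hx ∉ P := by
  let A : Ideal R :=
    { carrier := {x | ∃ hx : x ∈ m ^ 1, reesMonomial hx ∈ P}
      zero_mem' := ⟨zero_mem _, by
        convert P.zero_mem
        exact Subtype.ext (by simp)⟩
      add_mem' := by
        rintro x y ⟨hx, hx'⟩ ⟨hy, hy'⟩
        refine ⟨add_mem hx hy, ?_⟩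
        convert P.add_mem hx' hy'
        exact Subtype.ext (by simp)
      smul_mem' := by
        rintro c x ⟨hx, hx'⟩
        refine ⟨Ideal.mul_mem_left _ c hx, ?_⟩
        convert P.mul_mem_left (algebraMap R _ c) hx'
        exact Subtype.ext (by simp [C_mul_monomial]) }
  refine (ForGeneric.notMem (A := A) fun hA => ?_).mono fun x _ _ hxA hx hxP => hxA ⟨hx, hxP⟩
  obtain ⟨hprime, q, rfl⟩ := isAssociatedPrime_iff.1 hP
  obtain ⟨g, rfl⟩ := Ideal.Quotient.mk_surjective q
  -- Nakayama for (𝔪 + A)/A: some `r` in 1 + 𝔪 satisfies r𝔪 ⊆ A.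
  obtain ⟨r, hr, hrA⟩ := Submodule.exists_sub_one_mem_and_smul_eq_zero_of_fg_of_le_smul m
    (Submodule.map A.mkQ m) ((IsNoetherian.noetherian m).map _) (by
      rw [← Submodule.map_smul'']
      rintro _ ⟨x, hx, rfl⟩
      obtain ⟨a, ha, b, hb, rfl⟩ := Submodule.mem_sup.1 (hA hx)
      refine ⟨b, by rwa [smul_eq_mul, ← sq], ?_⟩
      rw [map_add, A.mkQ_apply a, (Submodule.Quotient.mk_eq_zero A).2 ha, zero_add])
  have hrP : algebraMap R (reesAlgebra m) r ∈ Submodule.colon ⊥ {Ideal.Quotient.mk (reesExt m I) g} := by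
    by_contra hrP
    refine hPm (reesPlus_le_iff.2 fun x hx => ?_)
    have h1 := hrA (A.mkQ x) ⟨x, by rwa [pow_one] at hx, rfl⟩
    rw [← map_smul, Submodule.mkQ_apply, Submodule.Quotient.mk_eq_zero] at h1
    obtain ⟨hx', hx''⟩ := h1
    refine (hprime.mem_or_mem (x := algebraMap R (reesAlgebra m) r) ?_).resolve_left hrP
    convert hx''
    exact Subtype.ext (by simp [C_mul_monomial])
  -- `P` is the annihilator of the class of `g`, so rg ∈ ℛ(𝔪, I), and `hI` applied to each
  -- coefficient makes this class zero.
  refine hprime.ne_top ((Ideal.eq_top_iff_one _).2 ?_)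
  have h0 : Ideal.Quotient.mk (reesExt m I) g = 0 := by
    rw [Ideal.mem_colon_bot_mk_iff] at hrP
    refine Ideal.Quotient.eq_zero_iff_mem.2 fun k => hI k (1 - r) ?_ _ ?_
    · simpa using m.neg_mem hr
    · simpa using hrP k
  simp [h0]

/-- A generic `x` is filter-regular on `ℛ(𝔪)/ℛ(𝔪, I)`. -/
theorem forGeneric_exists_pow_reesPlus [m.IsMaximal] [Infinite (R ⧸ m)] {I : Ideal R}
    (hI : ∀ k, ∀ r ∈ m, ∀ f, (1 - r) * f ∈ I * m ^ k → f ∈ I * m ^ k) :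
    ForGeneric m fun x => ∀ k f, ∀ hf : f ∈ m ^ k, f * x ∈ I * m ^ (k + 1) →
      ∃ j, ∀ g ∈ reesPlus m ^ j, g * reesMonomial hf ∈ reesExt m I := by
  have hfin : (associatedPrimes (reesAlgebra m) (reesAlgebra m ⧸ reesExt m I)).Finite :=
    associatedPrimes.finite _ _
  refine (ForGeneric.finite_forall hfin
    (P := fun P x => ¬ reesPlus m ≤ P → ∀ hx : x ∈ m ^ 1, reesMonomial hx ∉ P)
    fun P hP => ?_).mono fun x hx _ h k f hf hfx => ?_
  · by_cases hPm : reesPlus m ≤ P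
    · exact .of_forall fun x _ _ h => absurd hPm h
    · exact (forGeneric_reesMonomial_notMem hI hP hPm).mono fun x _ _ h _ => h
  · have hx1 : x ∈ m ^ 1 := by rwa [pow_one]
    obtain ⟨j, hj⟩ := exists_pow_reesPlus_le
      (q := Ideal.Quotient.mk (reesExt m I) (reesMonomial hf)) fun P hP hle => by
        -- The element x t annihilates the class of f tᵏ, hence lies in `P`, against the choice of
        -- `x`.
        by_contra hPm
        refine h P hP hPm hx1 (hle ?_)
        refine Ideal.mem_colon_bot_mk_iff.2 fun i => ?_
        by_cases hi : k + 1 = i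
        · subst hi
          simpa [monomial_mul_monomial, add_comm 1 k, mul_comm x f] using hfx
        · have : 1 + k ≠ i := by omega
          simp [monomial_mul_monomial, coeff_monomial, this]
    exact ⟨j, fun g hg => Ideal.mem_colon_bot_mk_iff.1 (hj hg)⟩

/-- For a generic `x`, an element `f ∈ 𝔪ᵏ` with `f x ∈ I𝔪ᵏ⁺¹` lies in `I𝔪ᵏ` up to a power
of `𝔪`. -/
theorem forGeneric_exists_pow_mul_mem [m.IsMaximal] [Infinite (R ⧸ m)] {I : Ideal R}
    (hI : ∀ k, ∀ r ∈ m, ∀ f, (1 - r) * f ∈ I * m ^ k → f ∈ I * m ^ k) :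
    ForGeneric m fun x => ∀ k, ∀ f ∈ m ^ k, f * x ∈ I * m ^ (k + 1) →
      ∃ j, ∀ c ∈ m ^ j, c * f ∈ I * m ^ (k + j) := by
  refine (forGeneric_exists_pow_reesPlus hI).mono fun x _ _ h k f hf hfx => ?_
  obtain ⟨j, hj⟩ := h k f hf hfx
  refine ⟨j, fun c hc => ?_⟩
  simpa [monomial_mul_monomial, add_comm j k] using
    hj _ (reesMonomial_mem_reesPlus_pow hc) (k + j)

end Rees

/-! ### Consequences of positive depth of R and of gr -/

section Depth

theorem IsSMulRegular.eq_zero_of_pow_mul_eq_zero {A : Type*} [CommRing A] {a b : A}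
    (h : IsSMulRegular A a) (j : ℕ) (hb : a ^ j * b = 0) : b = 0 :=
  h.pow j (by simpa using hb)

theorem Ideal.mem_of_mem_mul {A : Type*} [CommRing A] {I J : Ideal A} {a : A} (h : a ∈ I * J) :
    a ∈ J :=
  (Ideal.mul_le_right : I * J ≤ J) h

theorem exists_isSMulRegular_of_ringDepth_pos {A : Type*} [CommRing A] {J : Ideal A}
    (h : 0 < ringDepth J) : Nontrivial A ∧ ∃ a ∈ J, IsSMulRegular A a := by
  simp only [ringDepth, lt_iSup_iff] at h
  obtain ⟨s, ⟨hs, hreg⟩, hpos⟩ := h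
  cases s with
  | nil => simp at hpos
  | cons a s =>
    have := hreg.nontrivial
    exact ⟨this, a, hs a (by simp), ((RingTheory.Sequence.isWeaklyRegular_cons_iff A a s).1
      hreg.toIsWeaklyRegular).1⟩

/-- 1 - r divides 1 - rᵏ, and rᵏf ∈ 𝔪ᵏ. This provides `hI` for I = 𝔪 without locality or grading. -/
theorem mem_pow_of_one_sub_mul_mem {R : Type*} [CommRing R] {m : Ideal R} {r f : R} (hr : r ∈ m) {k : ℕ}
    (h : (1 - r) * f ∈ m ^ k) : f ∈ m ^ k := by
  have : (1 - r ^ k) * f ∈ m ^ k := by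
    obtain ⟨c, hc⟩ := sub_dvd_pow_sub_pow 1 r k
    rw [one_pow] at hc
    rw [hc, mul_comm _ c, mul_assoc]
    exact Ideal.mul_mem_left _ _ h
  have h2 := add_mem this (Ideal.mul_mem_right f _ (Ideal.pow_mem_pow hr k))
  rwa [← add_mul, sub_add_cancel, one_mul] at h2

variable {R : Type*} [CommRing R] [IsNoetherianRing R] {m : Ideal R} [m.IsMaximal]

theorem not_le_sq_of_ringDepth_pos (h : 0 < ringDepth m) : ¬ m ≤ m ^ 2 := by
  intro hle
  obtain ⟨_, a, ha, hreg⟩ := exists_isSMulRegular_of_ringDepth_pos h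
  obtain ⟨r, hr, hrm⟩ := Submodule.exists_sub_one_mem_and_smul_eq_zero_of_fg_of_le_smul m m
    (IsNoetherian.noetherian m) (by rwa [smul_eq_mul, ← sq])
  -- Nakayama's `r` in 1 + 𝔪 kills 𝔪, in particular the regular element `a`.
  have h0 : r = 0 := hreg (by simpa [mul_comm] using hrm a ha)
  refine Ideal.IsPrime.ne_top' (I := m) ((Ideal.eq_top_iff_one _).2 ?_)
  simpa [h0] using hr

/-- If `gr_𝔪(R)` has positive depth, then a generic `x ∈ 𝔪` has a regular initial form. -/
theorem forGeneric_mem_pow [Infinite (R ⧸ m)] (h : 0 < grDepth m) :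
    ForGeneric m fun x => ∀ k f, f * x ∈ m ^ (k + 1) → f ∈ m ^ k := by
  obtain ⟨_, a, ha, hreg⟩ := exists_isSMulRegular_of_ringDepth_pos h
  obtain ⟨g, hg, rfl⟩ := (Ideal.mem_map_iff_of_surjective _ Ideal.Quotient.mk_surjective).1 ha
  refine (forGeneric_exists_pow_reesPlus (m := m) (I := m) fun k r hr f hf => ?_).mono
    fun x _ _ hx k => ?_
  · rw [← pow_succ'] at hf ⊢
    exact mem_pow_of_one_sub_mul_mem hr hf
  · induction k with
    | zero => simp
    | succ k ih =>
      intro f hf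
      have hfk := ih f (Ideal.pow_le_pow_right (by omega) hf)
      obtain ⟨j, hj⟩ := hx k f hfk (by rwa [← pow_succ'])
      -- The class of f tᵏ in gr is killed by a power of gr₊, hence by a power of a regular element.
      have h0 : Ideal.Quotient.mk (reesExt m m) (reesMonomial hfk) = 0 := by
        refine hreg.eq_zero_of_pow_mul_eq_zero j ?_
        rw [← map_pow, ← map_mul]
        exact Ideal.Quotient.eq_zero_iff_mem.2 (hj _ (Ideal.pow_mem_pow hg j))
      rw [pow_succ']
      exact (reesMonomial_mem_reesExt hfk).1 (Ideal.Quotient.eq_zero_iff_mem.1 h0)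

end Depth

/-! ### Comparison and finiteness of the Dao numbers -/

section Dao

variable {R : Type*} [CommRing R] {m I : Ideal R}

theorem leastStable_le_leastStable {P Q : Ideal R → Prop}
    (h : ∀ l, (∀ k, l ≤ k → P (I * m ^ k)) → ∀ k, l ≤ k → Q (I * m ^ k)) :
    leastStable Q m I ≤ leastStable P m I :=
  le_iInf₂ fun l hl => iInf₂_le l (h l hl)

theorem leastStable_le {P : Ideal R → Prop} {l : ℕ} (h : ∀ k, l ≤ k → P (I * m ^ k)) :
    leastStable P m I ≤ l :=
  iInf₂_le l h

theorem isWeaklyMFull_iff {J : Ideal R} :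
    IsWeaklyMFull m J ↔ ∀ f, (∀ s ∈ m, f * s ∈ J * m) → f ∈ J := by
  refine ⟨fun h f hf => ?_, fun h => le_antisymm (fun f hf => h f ?_) fun f hf => ?_⟩
  · rw [← h.le.antisymm h.ge]
    exact Submodule.mem_colon.2 hf
  · exact Submodule.mem_colon.1 hf
  · exact Submodule.mem_colon.2 fun s hs => Ideal.mul_mem_mul hf hs

/-- If fx ∈ J and s ∈ 𝔪, then (fs)x ∈ J𝔪, so fs ∈ (J𝔪 : x) = J. -/
theorem IsMFull.isFull {J : Ideal R} (h : IsMFull m J) : IsFull m J := by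
  refine ForGeneric.mono h fun x hx _ hJ => le_antisymm (fun f hf => ?_)
    (Submodule.colon_mono le_rfl (by simpa using hx))
  refine Submodule.mem_colon.2 fun s hs => ?_
  rw [← hJ]
  rw [Submodule.mem_colon_singleton, smul_eq_mul] at hf ⊢
  rw [smul_eq_mul, mul_right_comm]
  exact Ideal.mul_mem_mul hf hs

theorem IsMFull.isWeaklyMFull [m.IsMaximal] [Infinite (R ⧸ m)] (hm : ¬ m ≤ m ^ 2) {J : Ideal R}
    (h : IsMFull m J) : IsWeaklyMFull m J := by
  obtain ⟨x, hx, -, hJ⟩ := ForGeneric.exists h hm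
  refine isWeaklyMFull_iff.2 fun f hf => ?_
  rw [← hJ]
  exact Submodule.mem_colon_singleton.2 (hf x hx)

/-- Weak fullness of I𝔪ᵏ⁺ʲ lowers the exponent from j + 1 to j. -/
theorem mem_of_forall_pow_mul_mem {l : ℕ} (h : ∀ k, l ≤ k → IsWeaklyMFull m (I * m ^ k)) {k : ℕ}
    (hk : l ≤ k) {f : R} (j : ℕ) (hf : ∀ c ∈ m ^ j, c * f ∈ I * m ^ (k + j)) : f ∈ I * m ^ k := by
  induction j with
  | zero => simpa using hf 1 (by simp)
  | succ j ih =>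
    refine ih fun c hc => isWeaklyMFull_iff.1 (h (k + j) (by omega)) _ fun s hs => ?_
    rw [mul_assoc, ← pow_succ, mul_right_comm]
    exact hf _ (by rw [pow_succ]; exact Ideal.mul_mem_mul hc hs)

theorem dao₂_le_dao₁ : dao₂ m I ≤ dao₁ m I :=
  leastStable_le_leastStable fun _ h k hk => (h k hk).isFull

variable [IsNoetherianRing R] [m.IsMaximal] [Infinite (R ⧸ m)]

theorem isMFull_of_forall_isWeaklyMFull (hgr : 0 < grDepth m)
    (hI : ∀ k, ∀ r ∈ m, ∀ f, (1 - r) * f ∈ I * m ^ k → f ∈ I * m ^ k) {l : ℕ}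
    (h : ∀ k, l ≤ k → IsWeaklyMFull m (I * m ^ k)) {k : ℕ} (hk : l ≤ k) :
    IsMFull m (I * m ^ k) := by
  refine ((forGeneric_mem_pow hgr).and (forGeneric_exists_pow_mul_mem hI)).mono
    fun x hx _ hx12 => le_antisymm (fun f hf => ?_) fun f hf =>
      Submodule.mem_colon_singleton.2 (Ideal.mul_mem_mul hf hx)
  have hf' : f * x ∈ I * m ^ (k + 1) := by
    rw [pow_succ, ← mul_assoc]
    exact Submodule.mem_colon_singleton.1 hf
  -- Only now is f tᵏ an element of ℛ(𝔪), to which filter-regularity of `x` applies.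
  have hfk : f ∈ m ^ k := hx12.1 k f (Ideal.mem_of_mem_mul hf')
  obtain ⟨j, hj⟩ := hx12.2 k f hfk hf'
  exact mem_of_forall_pow_mul_mem h hk j hj

theorem dao₃_eq_dao₁ (hR : 0 < ringDepth m) (hgr : 0 < grDepth m)
    (hI : ∀ k, ∀ r ∈ m, ∀ f, (1 - r) * f ∈ I * m ^ k → f ∈ I * m ^ k) :
    dao₃ m I = dao₁ m I :=
  le_antisymm
    (leastStable_le_leastStable fun _ h k hk =>
      (h k hk).isWeaklyMFull (not_le_sq_of_ringDepth_pos hR))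
    (leastStable_le_leastStable fun _ h _ hk => isMFull_of_forall_isWeaklyMFull hgr hI h hk)

theorem mem_pow_of_forall_mul_mem (hR : 0 < ringDepth m) (hgr : 0 < grDepth m) {k : ℕ} {f : R}
    (hf : ∀ s ∈ m, f * s ∈ m ^ (k + 1)) : f ∈ m ^ k := by
  obtain ⟨x, hx, -, h⟩ := (forGeneric_mem_pow hgr).exists (not_le_sq_of_ringDepth_pos hR)
  exact h k f (hf x hx)

/-- The ideals (I𝔪ᵏ⁺¹ : 𝔪) form an 𝔪-filtration, contained in the 𝔪-adic one since gr has positive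
depth; by Artin–Rees it is stable, so for large k (I𝔪ᵏ⁺² : 𝔪) = 𝔪(I𝔪ᵏ⁺¹ : 𝔪) ⊆ I𝔪ᵏ⁺¹. -/
theorem dao₃_lt_top (hR : 0 < ringDepth m) (hgr : 0 < grDepth m) : dao₃ m I < ⊤ := by
  let F : m.Filtration R :=
    { N := fun k => (I * m ^ k * m).colon (m : Set R)
      mono := fun k => Submodule.colon_mono
        (Ideal.mul_mono_left (Ideal.mul_mono_right (Ideal.pow_le_pow_right k.le_succ))) le_rfl
      smul_le := fun k => Submodule.smul_le.2 fun s hs f hf => Submodule.mem_colon.2 fun t ht => by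
        have := Submodule.mem_colon.1 hf s hs
        rw [mul_assoc, ← pow_succ] at this
        rw [smul_eq_mul, smul_eq_mul, mul_comm s f]
        exact Ideal.mul_mem_mul this ht }
  have hF : F ≤ m.stableFiltration ⊤ := by
    intro k f hf
    have hfk : f ∈ m ^ k := mem_pow_of_forall_mul_mem hR hgr fun s hs => by
      have := Submodule.mem_colon.1 hf s hs
      rw [mul_assoc, ← pow_succ] at this
      exact Ideal.mem_of_mem_mul this
    change f ∈ m ^ k • (⊤ : Ideal R)
    rw [smul_eq_mul, Ideal.mul_top]
    exact hfk
  obtain ⟨l, hl⟩ := (m.stableFiltration_stable ⊤).of_le hF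
  refine (leastStable_le (l := l + 1) fun k hk => ?_).trans_lt (ENat.natCast_lt_top _)
  obtain ⟨k, rfl⟩ : ∃ j, k = j + 1 := ⟨k - 1, by omega⟩
  refine isWeaklyMFull_iff.2 fun f hf => ?_
  have : f ∈ F.N (k + 1) := Submodule.mem_colon.2 hf
  rw [← hl k (by omega)] at this
  rw [pow_succ, ← mul_assoc]
  refine (Submodule.smul_le.2 fun s hs g hg => ?_) this
  rw [smul_eq_mul, mul_comm s g]
  exact Submodule.mem_colon.1 hg s hs

end Dao


/-! ### The Koszul complex -/

section KoszulComplex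

variable {S : Type*} [CommRing S] {n : ℕ} {y : Fin n → S} {M : Type*} [AddCommGroup M] [Module S M]

theorem koszulD_apply (x : Finset (Fin n) → M) (T : Finset (Fin n)) :
    koszulD y M x T = ∑ a ∈ Tᶜ, ((-1) ^ (T.filter (· < a)).card * y a) • x (insert a T) :=
  rfl

theorem neg_one_pow_card_filter_insert {T : Finset (Fin n)} {a : Fin n} (ha : a ∉ T) (b : Fin n) :
    (-1 : S) ^ ((insert a T).filter (· < b)).card =
      (if a < b then -1 else 1) * (-1) ^ (T.filter (· < b)).card := by
  rw [Finset.filter_insert]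
  split_ifs
  · rw [Finset.card_insert_of_notMem (by simp [ha]), pow_succ']
  · rw [one_mul]

theorem neg_one_pow_card_filter_insert_swap {T : Finset (Fin n)} {a b : Fin n} (ha : a ∉ T)
    (hb : b ∉ T) (hab : a ≠ b) :
    (-1 : S) ^ (T.filter (· < a)).card * (-1) ^ ((insert a T).filter (· < b)).card =
      -((-1) ^ (T.filter (· < b)).card * (-1) ^ ((insert b T).filter (· < a)).card) := by
  rw [neg_one_pow_card_filter_insert ha, neg_one_pow_card_filter_insert hb]
  rcases lt_or_gt_of_ne hab with h | h
  · simp [h, h.not_gt, mul_comm]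
  · simp [h, h.not_gt, mul_comm]

theorem koszulD_koszulD (x : Finset (Fin n) → M) : koszulD y M (koszulD y M x) = 0 := by
  ext T
  rw [koszulD_apply, Pi.zero_apply]
  -- Zero diagonal terms let the sum run over all pairs, where swapping `a` and `b` changes the
  -- sign.
  have h : ∀ a ∈ Tᶜ, ((-1) ^ (T.filter (· < a)).card * y a) • koszulD y M x (insert a T) =
      ∑ b ∈ Tᶜ, if a = b then 0 else
        (((-1) ^ (T.filter (· < a)).card * (-1) ^ ((insert a T).filter (· < b)).card) *
          (y a * y b)) • x (insert b (insert a T)) := by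
    intro a ha
    rw [koszulD_apply, Finset.smul_sum, Finset.compl_insert, ← Finset.add_sum_erase _ _ ha,
      if_pos rfl, zero_add]
    refine Finset.sum_congr rfl fun b hb => ?_
    rw [if_neg (Finset.ne_of_mem_erase hb).symm, smul_smul]
    congr 1
    ring
  rw [Finset.sum_congr rfl h, ← Finset.sum_product']
  refine Finset.sum_involution (fun p _ => p.swap) ?_ ?_ ?_ ?_
  · rintro ⟨a, b⟩ hp
    simp only [Finset.mem_product, Finset.mem_compl] at hp
    rcases eq_or_ne a b with rfl | hab
    · simp
    · simp only [Prod.fst_swap, Prod.snd_swap, hab, hab.symm, if_false]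
      rw [neg_one_pow_card_filter_insert_swap hp.1 hp.2 hab, Finset.insert_comm b a T,
        mul_comm (y b), ← add_smul]
      simp
  · rintro ⟨a, b⟩ _ h heq
    simp only [Prod.swap_prod_mk, Prod.mk.injEq] at heq
    simp [heq.1] at h
  · rintro ⟨a, b⟩ hp
    simpa [and_comm] using hp
  · rintro ⟨a, b⟩ _
    rfl

/-- Multiplication by `y_a` is zero on Koszul homology: the homotopy is the exterior product
with `e_a`. -/
theorem exists_koszulD_eq_smul {z : Finset (Fin n) → M} (hz : koszulD y M z = 0) (a : Fin n) :
    koszulD y M (fun T => if a ∈ T then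
      (-1 : S) ^ ((T.erase a).filter (· < a)).card • z (T.erase a) else 0) = y a • z := by
  ext T
  rw [koszulD_apply, Pi.smul_apply]
  by_cases ha : a ∈ T
  · obtain ⟨T, haT, rfl⟩ : ∃ T', a ∉ T' ∧ insert a T' = T :=
      ⟨T.erase a, by simp, Finset.insert_erase ha⟩
    -- The cycle condition at `T`, scaled by the sign of `a`, solves for `y a • z (insert a T)`.
    have h0 := congrFun hz T
    rw [koszulD_apply, Pi.zero_apply, ← Finset.add_sum_erase _ _ (Finset.mem_compl.2 haT),
      ← Finset.compl_insert] at h0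
    have h1 := congrArg (fun v => (-1 : S) ^ (T.filter (· < a)).card • v) h0
    simp only [smul_add, smul_zero, smul_smul, Finset.smul_sum] at h1
    rw [← mul_assoc, ← mul_pow, neg_one_mul, neg_neg, one_pow, one_mul] at h1
    rw [eq_neg_of_add_eq_zero_left h1, ← Finset.sum_neg_distrib]
    refine Finset.sum_congr rfl fun b hb => ?_
    simp only [Finset.mem_compl, Finset.mem_insert, not_or] at hb
    have hbT : (insert b (insert a T)).erase a = insert b T := by
      rw [Finset.insert_comm, Finset.erase_insert]
      simp [haT, Ne.symm hb.1]
    rw [if_pos (by simp), hbT, smul_smul, ← neg_smul]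
    congr 1
    rw [mul_right_comm, neg_one_pow_card_filter_insert haT, neg_one_pow_card_filter_insert hb.2]
    rcases lt_or_gt_of_ne hb.1 with h | h
    · simp [h, h.not_gt]; ring
    · simp [h, h.not_gt]; ring
  · rw [Finset.sum_eq_single_of_mem a (Finset.mem_compl.2 ha)]
    · rw [if_pos (Finset.mem_insert_self _ _), Finset.erase_insert ha, smul_smul, mul_right_comm,
        ← mul_pow, neg_one_mul, neg_neg, one_pow, one_mul]
    · intro b _ hb
      rw [if_neg (by simp [ha, hb.symm]), smul_zero]

/-- Used with `f` and `g` taking coefficients of tʲ⁺¹ and tʲ, so that the base ring changes from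
ℛ(𝔪) to R. -/
theorem map_koszulD {S' : Type*} [CommRing S'] {x : Fin n → S'} {M' : Type*} [AddCommGroup M']
    [Module S' M'] {f g : M →+ M'} (h : ∀ a v, f (y a • v) = x a • g v)
    (z : Finset (Fin n) → M) (T : Finset (Fin n)) :
    f (koszulD y M z T) = koszulD x M' (fun U => g (z U)) T := by
  rw [koszulD_apply, koszulD_apply, map_sum]
  refine Finset.sum_congr rfl fun a _ => ?_
  rw [mul_smul, mul_smul]
  rcases Nat.even_or_odd (T.filter (· < a)).card with h1 | h1 <;> simp [h1.neg_one_pow, h]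

theorem koszulD_congr {z z' : Finset (Fin n) → M} {T : Finset (Fin n)}
    (h : ∀ a ∉ T, z (insert a T) = z' (insert a T)) : koszulD y M z T = koszulD y M z' T := by
  rw [koszulD_apply, koszulD_apply]
  exact Finset.sum_congr rfl fun a ha => by rw [h a (Finset.mem_compl.1 ha)]

theorem koszulHomologyPiece_eq_bot_iff {ℳ : ℕ → AddSubgroup M} {i r : ℕ} :
    koszulHomologyPiece y ℳ i r = ⊥ ↔
      ∀ z ∈ koszulCycles y M i, (∀ T, z T ∈ ℳ r) → z ∈ koszulBoundaries y M i := by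
  rw [koszulHomologyPiece, AddSubgroup.map_eq_bot_iff]
  constructor
  · intro h z hz hzr
    have := h (x := ⟨z, hz⟩) (fun T _ => hzr T)
    have hmem : (⟨z, hz⟩ : koszulCycles y M i) ∈
        (koszulBoundaries y M i).comap (koszulCycles y M i).subtype :=
      (Submodule.Quotient.mk_eq_zero _).1 this
    exact hmem
  · rintro h ⟨z, hz⟩ hzr
    exact (Submodule.Quotient.mk_eq_zero _).2 (h z hz fun T => hzr T trivial)

theorem le_cmRegularity {ℳ : ℕ → AddSubgroup M} {i r : ℕ} (h : koszulHomologyPiece y ℳ i r ≠ ⊥) :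
    ((r : ℕ∞) : WithBot ℕ∞) ≤ cmRegularity y ℳ :=
  le_iSup_of_le i (le_iSup_of_le r (le_iSup_of_le h le_rfl))

/-- The cycles with coefficients in `I𝔪ʳ`, where `𝔪` is generated by `y`, are boundaries of chains
with coefficients in `I𝔪ʳ⁻¹` for large `r`. -/
theorem exists_forall_exists_koszulD_eq [IsNoetherianRing S] (I : Ideal S) :
    ∃ d, ∀ r, d ≤ r → ∀ w : Finset (Fin n) → S,
      (∀ T, w T ∈ I * Ideal.span (Set.range y) ^ (r + 1)) → koszulD y S w = 0 →
      ∃ b, (∀ T, b T ∈ I * Ideal.span (Set.range y) ^ r) ∧ koszulD y S b = w := by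
  set m := Ideal.span (Set.range y) with hm
  -- Cycles with coefficients in I𝔪ʳ, in all homological degrees at once.
  let F : m.Filtration (Finset (Fin n) → S) :=
    { N := fun r => Submodule.pi Set.univ (fun _ => I * m ^ r) ⊓ LinearMap.ker (koszulD y S)
      mono := fun r => inf_le_inf_right _ (Submodule.pi_mono fun _ _ =>
        Ideal.mul_mono_right (Ideal.pow_le_pow_right r.le_succ))
      smul_le := fun r => Submodule.smul_le.2 fun s hs w hw =>
        ⟨fun T _ => by
          have := Ideal.mul_mem_mul (hw.1 T trivial) hs
          rw [mul_assoc, ← pow_succ, mul_comm (w T) s] at this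
          exact this, Submodule.smul_mem _ s hw.2⟩ }
  have hF : F ≤ m.stableFiltration ⊤ := by
    intro r w hw
    change w ∈ m ^ r • (⊤ : Submodule S (Finset (Fin n) → S))
    have hw' : w = ∑ T, w T • (Pi.single T 1 : Finset (Fin n) → S) := by
      ext U
      simp [Finset.sum_apply, Pi.single_apply]
    rw [hw']
    exact sum_mem fun T _ =>
      Submodule.smul_mem_smul (Ideal.mem_of_mem_mul (hw.1 T trivial)) Submodule.mem_top
  obtain ⟨d, hd⟩ := (m.stableFiltration_stable ⊤).of_le hF
  refine ⟨d, fun r hr w hw hw0 => ?_⟩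
  have hwF : w ∈ F.N (r + 1) := ⟨fun T _ => hw T, hw0⟩
  rw [← hd r hr] at hwF
  -- By stability the cycle `w` lies in 𝔪 times cycles of level `r`; the homotopy for `y a` only
  -- permutes coefficients up to sign, so they stay in I𝔪ʳ.
  suffices hle : m • F.N r ≤
      Submodule.map (koszulD y S) (Submodule.pi Set.univ (fun _ => I * m ^ r)) by
    obtain ⟨b, hb, hbw⟩ := hle hwF
    exact ⟨b, fun T => hb T trivial, hbw⟩
  refine Submodule.smul_le.2 fun s hs z hz => ?_
  rw [hm] at hs
  induction hs using Submodule.span_induction with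
  | mem s hs =>
    obtain ⟨a, rfl⟩ := hs
    refine ⟨_, fun T _ => ?_, exists_koszulD_eq_smul hz.2 a⟩
    dsimp only
    split_ifs
    · exact Ideal.mul_mem_left _ _ (hz.1 _ trivial)
    · exact zero_mem _
  | zero => simp
  | add s t _ _ hs ht => rw [add_smul]; exact add_mem hs ht
  | smul c s _ hs => rw [smul_assoc]; exact Submodule.smul_mem _ c hs

end KoszulComplex


/-! ### Regularity of ℛ(𝔪, I) -/

section Regularity

local instance reesExt.module {R : Type*} [CommRing R] {m I : Ideal R} :
    Module (reesAlgebra m) (reesExt m I) :=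
  Submodule.module _

variable {R : Type*} [CommRing R] {m I : Ideal R} {n : ℕ} {y : Fin n → reesAlgebra m}

/-- Minimal homogeneous generators of `ℛ(𝔪)₊` are of the form `x₁t, …, xₙt`, where `x₁, …, xₙ`
generate `𝔪`. -/
theorem IsMinimalReesGenerators.exists_eq_monomial (hy : IsMinimalReesGenerators m y) :
    ∃ x : Fin n → R, (∀ a, (y a : R[X]) = monomial 1 (x a)) ∧ Ideal.span (Set.range x) = m := by
  have hplus : ∀ a, (y a : R[X]).coeff 0 = 0 := fun a => by
    have : y a ∈ reesPlus m := hy.span_eq ▸ Ideal.subset_span ⟨a, rfl⟩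
    exact this
  have hx : ∀ a, (y a : R[X]).coeff 1 ∈ m ^ 1 := fun a => (y a).2 1
  have hsum : ∀ f ∈ m ^ 1, ∃ c : Fin n → R, f = ∑ a, c a * (y a : R[X]).coeff 1 := by
    intro f hf
    have hf' : reesMonomial hf ∈ Ideal.span (Set.range y) :=
      hy.span_eq ▸ reesPlus_le_iff.1 le_rfl f hf
    obtain ⟨c, hc⟩ := Ideal.mem_span_range_iff_exists_fun.1 hf'
    refine ⟨fun a => (c a : R[X]).coeff 0, ?_⟩
    have := congrArg (fun p : reesAlgebra m => (p : R[X]).coeff 1) hc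
    simp only [AddSubmonoidClass.coe_finsetSum, MulMemClass.coe_mul, finsetSum_coeff,
      coeff_monomial_same] at this
    rw [← this]
    refine Finset.sum_congr rfl fun a _ => ?_
    rw [mul_coeff_one, hplus, mul_zero, add_zero]
  -- A generator not of degree one has zero coefficient of t; the others then generate degree one,
  -- hence ℛ(𝔪)₊, and it is redundant.
  have hdeg : ∀ a, y a = reesMonomial (hx a) := by
    intro a
    by_contra ha
    refine hy.minimal a ?_
    suffices h : reesPlus m ≤ Ideal.span (y '' {a}ᶜ) from
      h (hplus a)
    refine reesPlus_le_iff.2 fun f hf => ?_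
    obtain ⟨c, rfl⟩ := hsum f hf
    have : reesMonomial hf = ∑ b, algebraMap R _ (c b) * reesMonomial (hx b) := by
      apply Subtype.ext
      simp [AddSubmonoidClass.coe_finsetSum, C_mul_monomial]
    rw [this]
    refine sum_mem fun b _ => Ideal.mul_mem_left _ _ ?_
    obtain ⟨k, hk⟩ := hy.homogeneous b
    by_cases hk1 : k = 1
    · subst hk1
      have hb : y b = reesMonomial (hx b) := by
        apply Subtype.ext
        ext j
        rcases eq_or_ne j 1 with rfl | hj
        · simp
        · rw [hk j hj, coeff_monomial_of_ne _ hj]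
      rw [← hb]
      exact Ideal.subset_span ⟨b, fun hba => ha (Set.mem_singleton_iff.1 hba ▸ hb), rfl⟩
    · convert zero_mem (Ideal.span (y '' {a}ᶜ))
      exact Subtype.ext (by simp [hk 1 (Ne.symm hk1)])
  refine ⟨fun a => (y a : R[X]).coeff 1, fun a => congrArg Subtype.val (hdeg a), le_antisymm ?_ ?_⟩
  · rw [Ideal.span_le]
    rintro _ ⟨a, rfl⟩
    simpa using hx a
  · intro f hf
    obtain ⟨c, rfl⟩ := hsum f (by rwa [pow_one])
    exact sum_mem fun a _ => Ideal.mul_mem_left _ _ (Ideal.subset_span ⟨a, rfl⟩)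

/-- Taking the coefficient of `tʲ`, as an additive map on `ℛ(𝔪, I)`. -/
def reesExtCoeff (m I : Ideal R) (j : ℕ) : reesExt m I →+ R where
  toFun z := ((z : reesAlgebra m) : R[X]).coeff j
  map_zero' := by simp
  map_add' := by simp

theorem reesExt_ext {z z' : reesExt m I} (h : ∀ j, reesExtCoeff m I j z = reesExtCoeff m I j z') :
    z = z' :=
  Subtype.ext (Subtype.ext (Polynomial.ext h))

variable {x : Fin n → R}

theorem reesExtCoeff_koszulD_zero (hxy : ∀ a, (y a : R[X]) = monomial 1 (x a))
    (z : Finset (Fin n) → reesExt m I) (T : Finset (Fin n)) :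
    reesExtCoeff m I 0 (koszulD y (reesExt m I) z T) = 0 := by
  rw [map_koszulD (x := x) (g := (0 : reesExt m I →+ R))]
  · exact congrFun (map_zero (koszulD x R)) T
  · intro a v
    change ((y a : R[X]) * ((v : reesAlgebra m) : R[X])).coeff 0 = _
    rw [hxy, mul_coeff_zero]
    simp

theorem reesExtCoeff_koszulD_succ (hxy : ∀ a, (y a : R[X]) = monomial 1 (x a)) (j : ℕ)
    (z : Finset (Fin n) → reesExt m I) (T : Finset (Fin n)) :
    reesExtCoeff m I (j + 1) (koszulD y (reesExt m I) z T) =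
      koszulD x R (fun U => reesExtCoeff m I j (z U)) T := by
  refine map_koszulD (fun a v => ?_) z T
  change ((y a : R[X]) * ((v : reesAlgebra m) : R[X])).coeff (j + 1) = _
  rw [hxy, coeff_monomial_mul]
  rfl

theorem reesRegularity_lt_top [IsNoetherianRing R]
    (hxy : ∀ a, (y a : R[X]) = monomial 1 (x a)) (hxm : Ideal.span (Set.range x) = m) :
    reesRegularity m I y < ⊤ := by
  obtain ⟨d, hd⟩ := exists_forall_exists_koszulD_eq (y := x) I
  rw [hxm] at hd
  suffices h : reesRegularity m I y ≤ ((d : ℕ∞) : WithBot ℕ∞) from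
    h.trans_lt (WithBot.coe_lt_coe.2 (ENat.natCast_lt_top d))
  refine iSup_le fun i => iSup_le fun r => iSup_le fun hr => ?_
  by_contra! hlt
  have hdr : d < r := by exact_mod_cast hlt
  obtain ⟨r, rfl⟩ : ∃ s, r = s + 1 := ⟨r - 1, by omega⟩
  refine hr (koszulHomologyPiece_eq_bot_iff.2 fun z hz hzr => ?_)
  have hzr' : ∀ T j, j ≠ r + 1 → reesExtCoeff m I j (z T) = 0 := fun T j hj => hzr T j hj
  obtain ⟨b, hb, hbw⟩ := hd r (by omega) (fun T => reesExtCoeff m I (r + 1) (z T))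
    (fun T => (z T).2 (r + 1)) (by
      ext T
      rw [← reesExtCoeff_koszulD_succ hxy, show koszulD y (reesExt m I) z = 0 from hz.2]
      simp)
  -- Only the part of `b` in homological degree i + 1 is kept, the only one affecting degree i of
  -- the differential.
  let c : Finset (Fin n) → reesExt m I := fun T => if T.card = i + 1 then
    ⟨reesMonomial (Ideal.mem_of_mem_mul (hb T)), (reesMonomial_mem_reesExt _).2 (hb T)⟩ else 0
  have hc : ∀ T j, j ≠ r → reesExtCoeff m I j (c T) = 0 := by
    intro T j hj
    dsimp only [c]
    split_ifs
    · exact coeff_monomial_of_ne _ hj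
    · exact map_zero _
  have hcr : ∀ T, T.card = i + 1 → reesExtCoeff m I r (c T) = b T := by
    intro T hT
    dsimp only [c]
    rw [if_pos hT]
    exact coeff_monomial_same _ _
  refine ⟨c, fun T hT => if_neg hT, ?_⟩
  ext1 T
  by_cases hT : T.card = i
  · refine reesExt_ext fun j => ?_
    cases j with
    | zero => rw [reesExtCoeff_koszulD_zero hxy, hzr' T 0 (by omega)]
    | succ j =>
      rw [reesExtCoeff_koszulD_succ hxy]
      rcases eq_or_ne j r with rfl | hj
      · rw [← congrFun hbw T]
        exact koszulD_congr fun a ha => hcr _ (by rw [Finset.card_insert_of_notMem ha, hT])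
      · rw [hzr' T (j + 1) (by omega)]
        simp only [hc _ j hj]
        exact congrFun (map_zero (koszulD x R)) T
  · rw [hz.1 T hT]
    refine (koszulD_congr (z' := 0) fun a ha => if_neg ?_).trans
      (congrFun (map_zero (koszulD y (reesExt m I))) T)
    rw [Finset.card_insert_of_notMem ha]
    omega

/-- Boundaries have no term of degree 0, so a non-zero element of I survives in H₀. This excludes
the value `⊥`. -/
theorem zero_le_reesRegularity (hxy : ∀ a, (y a : R[X]) = monomial 1 (x a)) (hI : I ≠ ⊥) :
    ((0 : ℕ∞) : WithBot ℕ∞) ≤ reesRegularity m I y := by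
  obtain ⟨f, hf, hf0⟩ := I.ne_bot_iff.1 hI
  refine le_cmRegularity (i := 0) (r := 0) fun h => hf0 ?_
  have hf1 : f ∈ m ^ 0 := by simp
  let v : reesExt m I := ⟨reesMonomial hf1, (reesMonomial_mem_reesExt _).2 (by simpa using hf)⟩
  have hv : ∀ j, j ≠ 0 → reesExtCoeff m I j v = 0 := fun j hj => coeff_monomial_of_ne _ hj
  have hcyc : Pi.single ∅ v ∈ koszulCycles y (reesExt m I) 0 := by
    refine ⟨fun T hT => Pi.single_eq_of_ne (by rintro rfl; simp at hT) _, ?_⟩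
    ext1 T
    refine (koszulD_congr (z' := 0) fun a _ => ?_).trans
      (congrFun (map_zero (koszulD y (reesExt m I))) T)
    exact Pi.single_eq_of_ne (Finset.insert_ne_empty a T) _
  have hdeg : ∀ T : Finset (Fin n), (Pi.single ∅ v : Finset (Fin n) → reesExt m I) T ∈
      reesExtPiece m I 0 := by
    intro T j hj
    rcases eq_or_ne T ∅ with rfl | hT
    · rw [Pi.single_eq_same]
      exact hv j hj
    · rw [Pi.single_eq_of_ne hT]
      rfl
  obtain ⟨c, -, hc⟩ := koszulHomologyPiece_eq_bot_iff.1 h _ hcyc hdeg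
  have hc0 := reesExtCoeff_koszulD_zero hxy c ∅
  rw [hc, Pi.single_eq_same] at hc0
  rw [← hc0]
  exact (coeff_monomial_same 0 f).symm

/-- A socle element of degree `k` of `ℛ(𝔪)/ℛ(𝔪, I)` yields a non-zero element of
`H_{n-1}(y; ℛ(𝔪, I))_{n+k}`. -/
theorem le_reesRegularity_of_forall_mul_mem (hR : 0 < ringDepth m)
    (hxy : ∀ a, (y a : R[X]) = monomial 1 (x a)) (hxm : Ideal.span (Set.range x) = m) {k : ℕ}
    {f : R} (hfk : f ∈ m ^ k) (hf : ∀ s ∈ m, f * s ∈ I * m ^ (k + 1)) (hfI : f ∉ I * m ^ k) :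
    (((k + 1 : ℕ) : ℕ∞) : WithBot ℕ∞) ≤ reesRegularity m I y := by
  obtain ⟨_, a, ha, hreg⟩ := exists_isSMulRegular_of_ringDepth_pos hR
  have hxmem : ∀ b, x b ∈ m := fun b => hxm ▸ Ideal.subset_span ⟨b, rfl⟩
  obtain ⟨i, rfl⟩ : ∃ i, n = i + 1 := by
    cases n with
    | zero =>
      rw [Set.range_eq_empty, Ideal.span_empty] at hxm
      rw [← hxm, Ideal.mem_bot] at ha
      subst ha
      exact absurd (hreg (by simp : (0 : R) • (1 : R) = (0 : R) • 0)) one_ne_zero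
    | succ i => exact ⟨i, rfl⟩
  refine le_cmRegularity (i := i) (r := k + 1) fun h => hfI ?_
  -- The top chain f tᵏ e_{1…n} over `reesExt m ⊤`, which is all of ℛ(𝔪), as f tᵏ need not lie in
  -- ℛ(𝔪, I).
  let e : Finset (Fin (i + 1)) → reesExt m ⊤ :=
    Pi.single Finset.univ ⟨reesMonomial hfk, (reesMonomial_mem_reesExt _).2 (by simpa using hfk)⟩
  have he : ∀ U j, j ≠ k → reesExtCoeff m ⊤ j (e U) = 0 := by
    intro U j hj
    rcases eq_or_ne U Finset.univ with rfl | hU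
    · dsimp only [e]
      rw [Pi.single_eq_same]
      exact coeff_monomial_of_ne _ hj
    · dsimp only [e]
      rw [Pi.single_eq_of_ne hU, map_zero]
  have hek : ∀ U, reesExtCoeff m ⊤ k (e U) = if U = Finset.univ then f else 0 := by
    intro U
    rcases eq_or_ne U Finset.univ with rfl | hU
    · dsimp only [e]
      rw [Pi.single_eq_same, if_pos rfl]
      exact coeff_monomial_same _ _
    · dsimp only [e]
      rw [Pi.single_eq_of_ne hU, map_zero, if_neg hU]
  have hD : ∀ T j, j ≠ k + 1 → reesExtCoeff m ⊤ j (koszulD y (reesExt m ⊤) e T) = 0 := by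
    intro T j hj
    cases j with
    | zero => exact reesExtCoeff_koszulD_zero hxy e T
    | succ j =>
      rw [reesExtCoeff_koszulD_succ hxy]
      simp only [he _ j (by omega : j ≠ k)]
      exact congrFun (map_zero (koszulD x R)) T
  have hDk : ∀ T, reesExtCoeff m ⊤ (k + 1) (koszulD y (reesExt m ⊤) e T) ∈ I * m ^ (k + 1) := by
    intro T
    rw [reesExtCoeff_koszulD_succ hxy, koszulD_apply]
    refine sum_mem fun b _ => ?_
    rw [hek]
    split_ifs
    · rw [smul_eq_mul, mul_assoc, mul_comm (x b)]
      exact Ideal.mul_mem_left _ _ (hf _ (hxmem b))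
    · simp
  let z : Finset (Fin (i + 1)) → reesExt m I := fun T => ⟨koszulD y (reesExt m ⊤) e T, fun j => by
    rcases eq_or_ne j (k + 1) with rfl | hj
    · exact hDk T
    · exact (congrArg (· ∈ I * m ^ j) (hD T j hj)).mpr (zero_mem _)⟩
  have hz : ∀ T, ((z T : reesExt m I) : reesAlgebra m) = koszulD y (reesExt m ⊤) e T := fun T => rfl
  have hcyc : z ∈ koszulCycles y (reesExt m I) i := by
    refine ⟨?_, ?_⟩
    · intro T hT
      apply Subtype.ext
      rw [hz, koszulD_congr (z' := 0) fun b hb => ?_]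
      · simp
      · refine Pi.single_eq_of_ne (fun hU => hT ?_) _
        have := congrArg Finset.card hU
        rw [Finset.card_insert_of_notMem hb, Finset.card_univ, Fintype.card_fin] at this
        omega
    · ext1 T
      refine reesExt_ext fun j => ?_
      cases j with
      | zero => rw [reesExtCoeff_koszulD_zero hxy, Pi.zero_apply, map_zero]
      | succ j =>
        have h0 := reesExtCoeff_koszulD_succ hxy j (koszulD y (reesExt m ⊤) e) T
        rw [koszulD_koszulD, Pi.zero_apply, map_zero] at h0
        rw [reesExtCoeff_koszulD_succ hxy, Pi.zero_apply, map_zero]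
        exact h0.symm
  obtain ⟨c, -, hc⟩ := koszulHomologyPiece_eq_bot_iff.1 h z hcyc fun T j hj => hD T j hj
  suffices hcf : f = reesExtCoeff m I k (c Finset.univ) from
    hcf ▸ (c Finset.univ).2 k
  -- At the complement of {b} both differentials have the single term ± x_b times the top
  -- coefficient.
  have hxa : ∀ b, x b * (f - reesExtCoeff m I k (c Finset.univ)) = 0 := by
    intro b
    have h1 : reesExtCoeff m I (k + 1) (z {b}ᶜ) =
        reesExtCoeff m ⊤ (k + 1) (koszulD y (reesExt m ⊤) e {b}ᶜ) := rfl
    rw [← hc, reesExtCoeff_koszulD_succ hxy, reesExtCoeff_koszulD_succ hxy, koszulD_apply,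
      koszulD_apply, compl_compl, Finset.sum_singleton, Finset.sum_singleton,
      Finset.insert_compl_self, hek, if_pos rfl, smul_eq_mul, smul_eq_mul, mul_assoc,
      mul_assoc] at h1
    have h2 := (isUnit_one.neg.pow _).mul_left_cancel h1
    rw [mul_sub, h2, sub_self]
  refine sub_eq_zero.1 (hreg ?_)
  rw [← hxm] at ha
  change a * _ = a * 0
  rw [mul_zero]
  clear hreg
  induction ha using Submodule.span_induction with
  | mem s hs => obtain ⟨b, rfl⟩ := hs; exact hxa b
  | zero => simp
  | add s t _ _ hs ht => rw [add_mul, hs, ht, add_zero]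
  | smul c s _ hs => rw [smul_eq_mul, mul_assoc, hs, mul_zero]

end Regularity


/-! ### The regularity bound and the two settings -/

section Main

theorem dao₁_le_reesRegularity {R : Type*} [CommRing R] [IsNoetherianRing R] {m I : Ideal R}
    [m.IsMaximal] [Infinite (R ⧸ m)] (hR : 0 < ringDepth m) (hgr : 0 < grDepth m)
    (hI : ∀ k, ∀ r ∈ m, ∀ f, (1 - r) * f ∈ I * m ^ k → f ∈ I * m ^ k) (hI0 : I ≠ ⊥) {n : ℕ}
    {y : Fin n → reesAlgebra m} (hy : IsMinimalReesGenerators m y) :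
    (dao₁ m I : WithBot ℕ∞) ≤ reesRegularity m I y ∧ reesRegularity m I y < ⊤ := by
  obtain ⟨x, hxy, hxm⟩ := hy.exists_eq_monomial
  have htop := reesRegularity_lt_top (I := I) hxy hxm
  refine ⟨?_, htop⟩
  obtain ⟨e, he⟩ : ∃ e : ℕ, ((e : ℕ∞) : WithBot ℕ∞) = reesRegularity m I y := by
    have h0 := zero_le_reesRegularity hxy hI0
    obtain ⟨e, he, -⟩ := WithBot.coe_le_iff.1 h0
    rw [he] at htop
    lift e to ℕ using (WithBot.coe_lt_coe.1 htop).ne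
    exact ⟨e, he.symm⟩
  rw [← dao₃_eq_dao₁ hR hgr hI, ← he, WithBot.coe_le_coe]
  -- A failure at some k ≥ e would give regularity at least k + 1 > e.
  refine leastStable_le fun k hk => isWeaklyMFull_iff.2 fun f hf => ?_
  by_contra hfI
  simp only [mul_assoc, ← pow_succ] at hf
  have hfk : f ∈ m ^ k :=
    mem_pow_of_forall_mul_mem hR hgr fun s hs => Ideal.mem_of_mem_mul (hf s hs)
  have hle := le_reesRegularity_of_forall_mul_mem hR hxy hxm hfk hf hfI
  rw [← he, WithBot.coe_le_coe, Nat.cast_le] at hle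
  omega

section Graded

variable {K R : Type*} [Field K] [CommRing R] [Algebra K R] {𝒜 : ℕ → Submodule K R}
  [GradedAlgebra 𝒜]

theorem Ideal.IsHomogeneous.ideal_pow {J : Ideal R} (hJ : J.IsHomogeneous 𝒜) (k : ℕ) :
    (J ^ k).IsHomogeneous 𝒜 := by
  induction k with
  | zero => simpa using Ideal.IsHomogeneous.top 𝒜
  | succ k ih => rw [pow_succ]; exact ih.mul hJ

/-- An element of `1 + R₊` is a nonzerodivisor modulo a homogeneous ideal. -/
theorem Ideal.IsHomogeneous.mem_of_one_sub_mul_mem {J : Ideal R} (hJ : J.IsHomogeneous 𝒜) {r f : R}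
    (hr : r ∈ (HomogeneousIdeal.irrelevant 𝒜).toIdeal) (h : (1 - r) * f ∈ J) : f ∈ J := by
  classical
  have hr0 : (DirectSum.decompose 𝒜 r 0 : R) = 0 := hr
  suffices hd : ∀ d, (DirectSum.decompose 𝒜 f d : R) ∈ J by
    rw [← DirectSum.sum_support_decompose 𝒜 f]
    exact J.sum_mem fun d _ => hd d
  intro d
  induction d using Nat.strong_induction_on with
  | _ d ih =>
    -- As r₀ = 0, this component only involves components of `f` of degree below `d`.
    have hmul : (DirectSum.decompose 𝒜 (r * f) d : R) ∈ J := by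
      rw [DirectSum.decompose_mul, DirectSum.coe_mul_apply]
      refine J.sum_mem fun p hp => ?_
      obtain ⟨-, hpd⟩ := Finset.mem_filter.1 hp
      rcases Nat.eq_zero_or_pos p.1 with h0 | hpos
      · rw [h0, hr0, zero_mul]
        exact J.zero_mem
      · exact J.mul_mem_left _ (ih p.2 (by omega))
    have hsub := hJ d h
    rw [sub_mul, one_mul, DirectSum.decompose_sub, DirectSum.sub_apply,
      AddSubgroupClass.coe_sub] at hsub
    simpa using add_mem hsub hmul

theorem IsStandardGraded.isNoetherianRing (h : IsStandardGraded 𝒜) : IsNoetherianRing R := by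
  have : Algebra.FiniteType K R := by
    refine ⟨?_⟩
    obtain ⟨s, hs⟩ := Module.Finite.iff_fg.1 h.finite_one
    refine ⟨s, ?_⟩
    rw [← h.adjoin_eq_top, ← hs, Algebra.adjoin_span]
  exact Algebra.FiniteType.isNoetherianRing K R

theorem IsStandardGraded.exists_sub_algebraMap_mem (h : IsStandardGraded 𝒜) (f : R) :
    ∃ c : K, f - algebraMap K R c ∈ (HomogeneousIdeal.irrelevant 𝒜).toIdeal := by
  have h0 : (DirectSum.decompose 𝒜 f 0 : R) ∈ (1 : Submodule K R) :=
    h.zero_eq ▸ (DirectSum.decompose 𝒜 f 0).2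
  obtain ⟨c, hc⟩ := Submodule.mem_one.1 h0
  refine ⟨c, ?_⟩
  change (DirectSum.decompose 𝒜 (f - algebraMap K R c) 0 : R) = 0
  rw [hc, DirectSum.decompose_sub, DirectSum.sub_apply, AddSubgroupClass.coe_sub,
    DirectSum.decompose_coe, DirectSum.of_eq_same, sub_self]

/-- Modulo the irrelevant ideal every element is a scalar, hence zero or invertible. -/
theorem IsStandardGraded.isMaximal [Nontrivial R] (h : IsStandardGraded 𝒜) :
    (HomogeneousIdeal.irrelevant 𝒜).toIdeal.IsMaximal := by
  rw [Ideal.isMaximal_iff]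
  refine ⟨fun h1 => ?_, fun J f hJ hf hfJ => ?_⟩
  · have h0 : (DirectSum.decompose 𝒜 (1 : R) 0 : R) = 0 := h1
    rw [DirectSum.decompose_of_mem_same 𝒜 SetLike.GradedOne.one_mem] at h0
    exact one_ne_zero h0
  · obtain ⟨c, hc⟩ := h.exists_sub_algebraMap_mem f
    have hc0 : c ≠ 0 := by
      rintro rfl
      exact hf (by simpa using hc)
    have hcJ : algebraMap K R c ∈ J := by simpa using sub_mem hfJ (hJ hc)
    have := J.mul_mem_left (algebraMap K R c⁻¹) hcJ
    rwa [← map_mul, inv_mul_cancel₀ hc0, map_one] at this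

end Graded

end Main

end

theorem theorem1p3 :
    (∀ (R : Type*) [CommRing R] [IsNoetherianRing R] [IsLocalRing R]
        (m : Ideal R) (_ : m = IsLocalRing.maximalIdeal R) (I : Ideal R),
      Infinite (IsLocalRing.ResidueField R) →
      0 < ringDepth m →
      0 < grDepth m →
        dao₂ m I ≤ dao₃ m I ∧ dao₃ m I = dao₁ m I ∧ dao₁ m I < ⊤ ∧
        (I ≠ ⊥ → ∀ (n : ℕ) (y : Fin n → reesAlgebra m), IsMinimalReesGenerators m y →
          (dao₁ m I : WithBot ℕ∞) ≤ reesRegularity m I y ∧ reesRegularity m I y < ⊤)) ∧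
    (∀ (K R : Type*) [Field K] [CommRing R] [Algebra K R]
        (𝒜 : ℕ → Submodule K R) [GradedAlgebra 𝒜] (_ : IsStandardGraded 𝒜)
        (m : Ideal R) (_ : m = (HomogeneousIdeal.irrelevant 𝒜).toIdeal)
        (I : Ideal R) (_ : I.IsHomogeneous 𝒜),
      Infinite K →
      0 < ringDepth m →
      0 < grDepth m →
        dao₂ m I ≤ dao₃ m I ∧ dao₃ m I = dao₁ m I ∧ dao₁ m I < ⊤ ∧
        (I ≠ ⊥ → ∀ (n : ℕ) (y : Fin n → reesAlgebra m), IsMinimalReesGenerators m y →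
          (dao₁ m I : WithBot ℕ∞) ≤ reesRegularity m I y ∧ reesRegularity m I y < ⊤)) := by
  constructor
  · intro R _ _ _ m hm I hinf hR hgr
    have : m.IsMaximal := hm ▸ IsLocalRing.maximalIdeal.isMaximal R
    have : Infinite (R ⧸ m) := hm ▸ hinf
    have hI : ∀ k, ∀ r ∈ m, ∀ f, (1 - r) * f ∈ I * m ^ k → f ∈ I * m ^ k := by
      intro k r hr f hf
      subst hm
      exact (Ideal.unit_mul_mem_iff_mem _
        (IsLocalRing.isUnit_one_sub_self_of_mem_nonunits r hr)).1 hf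
    have h31 := dao₃_eq_dao₁ hR hgr hI
    exact ⟨h31 ▸ dao₂_le_dao₁, h31, h31 ▸ dao₃_lt_top hR hgr,
      fun hI0 n y hy => dao₁_le_reesRegularity hR hgr hI hI0 hy⟩
  · intro K R _ _ _ 𝒜 _ hst m hm I hIhom hinf hR hgr
    have : Nontrivial R := (exists_isSMulRegular_of_ringDepth_pos hR).1
    have : IsNoetherianRing R := hst.isNoetherianRing
    have : m.IsMaximal := hm ▸ hst.isMaximal
    have : Infinite (R ⧸ m) := Infinite.of_injective _ (algebraMap K (R ⧸ m)).injective
    have hI : ∀ k, ∀ r ∈ m, ∀ f, (1 - r) * f ∈ I * m ^ k → f ∈ I * m ^ k := by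
      intro k r hr f hf
      subst hm
      exact (hIhom.mul ((HomogeneousIdeal.irrelevant 𝒜).isHomogeneous.ideal_pow k)).mem_of_one_sub_mul_mem
        hr hf
    have h31 := dao₃_eq_dao₁ hR hgr hI
    exact ⟨h31 ▸ dao₂_le_dao₁, h31, h31 ▸ dao₃_lt_top hR hgr,
      fun hI0 n y hy => dao₁_le_reesRegularity hR hgr hI hI0 hy⟩
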